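/- Let Boolean PCF with Boolean references be the call-by-value language defined as follows. Types are $\tau ::= \mathtt{unit}\mid\mathtt{bool}\mid\tau_1\to\tau_2\mid\mathtt{ref}\,\mathtt{bool}$, where $\mathtt{unit}$ and $\mathtt{bool}$ are the base types. Expressions (up to renaming of bound variables) are $$M ::= \mathtt{fail}\mid ()\mid \mathtt{true}\mid\mathtt{false}\mid x\mid \lambda x.M\mid M_1M_2\mid Y(\lambda f.\lambda x.M)\mid \mathtt{if}\ M_0\ \mathtt{then}\ M_1\ \mathtt{else}\ M_2\mid \mathtt{ref}\,M\mid\, !M\mid M_1:=M_2 .$$ The typing judgment $\Gamma\vdash M:\tau$ is given by the rules of the simply typed $\lambda$-calculus for variables, abstraction and application, the usual rules for constants and conditionals (both branches of the same type), and: $\Gamma\vdash\mathtt{fail}:\tau$ for every $\tau$; $\Gamma\vdash Y(\lambda f.\lambda x.M):\tau_1\to\tau_2$ if $\Gamma,f:\tau_1\to\tau_2,x:\tau_1\vdash M:\tau_2$; $\Gamma\vdash\mathtt{ref}\,M:\mathtt{ref}\,\mathtt{bool}$ if $\Gamma\vdash M:\mathtt{bool}$; $\Gamma\vdash\, !M:\mathtt{bool}$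 if $\Gamma\vdash M:\mathtt{ref}\,\mathtt{bool}$; and $\Gamma\vdash M_1:=M_2:\mathtt{unit}$ if $\Gamma\vdash M_1:\mathtt{ref}\,\mathtt{bool}$ and $\Gamma\vdash M_2:\mathtt{bool}$. At run time expressions may also contain store locations $\ell$. Values $V$ are $()$, $\mathtt{true}$, $\mathtt{false}$, $\lambda x.M$ and $\ell$; a store $\mu$ is a finite map from locations to Booleans; evaluation contexts are $$E ::= [\,]\mid E\,M\mid V\,E\mid \mathtt{if}\ E\ \mathtt{then}\ M_1\ \mathtt{else}\ M_2\mid \mathtt{ref}\,E\mid\, !E\mid E:=M\mid \ell:=E .$$ Reduction on pairs of an expression and a store is given by $$\begin{aligned} (E[(\lambda x.M)V],\mu)&\to(E[[V/x]M],\mu),\\ (E[\mathtt{if}\ \mathtt{true}\ \mathtt{then}\ M_1\ \mathtt{else}\ M_2],\mu)&\to(E[M_1],\mu),\\ (E[\mathtt{if}\ \mathtt{false}\ \mathtt{then}\ M_1\ \mathtt{else}\ M_2],\mu)&\to(E[M_2],\mu),\\ (E[Y(\lambda f.\lambda x.M)],\mu)&\to(E[\lambda x.[Y(\lambda f.\lambda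 x.M)/f]M],\mu),\\ (E[\mathtt{fail}],\mu)&\to(\mathtt{fail},\mu),\\ (E[\mathtt{ref}\,b],\mu)&\to(E[\ell],\mu\cup\{\ell\mapsto b\})\quad\text{with }\ell\text{ fresh},\\ (E[\,!\ell],\mu)&\to(E[\mu(\ell)],\mu)\quad\text{if }\ell\in\mathrm{dom}(\mu),\\ (E[\ell:=b],\mu)&\to(E[()],\mu[\ell\mapsto b])\quad\text{if }\ell\in\mathrm{dom}(\mu), \end{aligned}$$ where $b\in\{\mathtt{true},\mathtt{false}\}$. Write $M\to^*\mathtt{fail}$ if $(M,\emptyset)$ reduces in zero or more steps to $(\mathtt{fail},\mu)$ for some store $\mu$. **Theorem.** The reachability problem for Boolean PCF with Boolean references is undecidable: there is no algorithm that, given a closed expression $M$ with $\vdash M:\beta$ for a base type $\beta$, halts and correctly decides whether $M\to^*\mathtt{fail}$ (even if nothing is required of the algorithm on other inputs). -/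

import Mathlib

namespace BPCFR

/-- Base types: `unit` and `bool`. -/
inductive BaseTy : Type
  | unit
  | bool

/-- Types: base types, function types, and the type of references to Booleans. -/
inductive Ty : Type
  | base (b : BaseTy)
  | fn (τ₁ τ₂ : Ty)
  | refBool

/-- Expressions, up to renaming of bound variables (de Bruijn indices).
`lam M` is `λ x. M` with `x` the variable `0` of `M`.
`fix M` is `Y (λ f. λ x. M)` with `x` the variable `0` and `f` the variable `1` of `M`.
`loc l` is a store location; it has no typing rule, so it arises only at run time. -/
inductive Term : Type
  | fail
  | unit
  | tt
  | ff
  | var (i : ℕ)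
  | loc (l : ℕ)
  | lam (M : Term)
  | app (M₁ M₂ : Term)
  | fix (M : Term)
  | ite (M₀ M₁ M₂ : Term)
  | mkref (M : Term)
  | deref (M : Term)
  | assign (M₁ M₂ : Term)

/-- The typing judgment `Γ ⊢ M : τ`; `Γ` lists the types of the variables `0, 1, …`. -/
inductive HasType : List Ty → Term → Ty → Prop
  | fail {Γ : List Ty} {τ : Ty} : HasType Γ Term.fail τ
  | unit {Γ : List Ty} : HasType Γ Term.unit (Ty.base BaseTy.unit)
  | tt {Γ : List Ty} : HasType Γ Term.tt (Ty.base BaseTy.bool)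
  | ff {Γ : List Ty} : HasType Γ Term.ff (Ty.base BaseTy.bool)
  | var {Γ : List Ty} {i : ℕ} {τ : Ty} : Γ[i]? = some τ → HasType Γ (Term.var i) τ
  | lam {Γ : List Ty} {M : Term} {τ₁ τ₂ : Ty} :
      HasType (τ₁ :: Γ) M τ₂ → HasType Γ (Term.lam M) (Ty.fn τ₁ τ₂)
  | app {Γ : List Ty} {M₁ M₂ : Term} {τ₁ τ₂ : Ty} :
      HasType Γ M₁ (Ty.fn τ₁ τ₂) → HasType Γ M₂ τ₁ → HasType Γ (Term.app M₁ M₂) τ₂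
  | fix {Γ : List Ty} {M : Term} {τ₁ τ₂ : Ty} :
      HasType (τ₁ :: Ty.fn τ₁ τ₂ :: Γ) M τ₂ → HasType Γ (Term.fix M) (Ty.fn τ₁ τ₂)
  | ite {Γ : List Ty} {M₀ M₁ M₂ : Term} {τ : Ty} :
      HasType Γ M₀ (Ty.base BaseTy.bool) → HasType Γ M₁ τ → HasType Γ M₂ τ →
      HasType Γ (Term.ite M₀ M₁ M₂) τ
  | mkref {Γ : List Ty} {M : Term} :
      HasType Γ M (Ty.base BaseTy.bool) → HasType Γ (Term.mkref M) Ty.refBool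
  | deref {Γ : List Ty} {M : Term} :
      HasType Γ M Ty.refBool → HasType Γ (Term.deref M) (Ty.base BaseTy.bool)
  | assign {Γ : List Ty} {M₁ M₂ : Term} :
      HasType Γ M₁ Ty.refBool → HasType Γ M₂ (Ty.base BaseTy.bool) →
      HasType Γ (Term.assign M₁ M₂) (Ty.base BaseTy.unit)

namespace Term

/-- Lift a renaming under one binder. -/
def upRen (ρ : ℕ → ℕ) : ℕ → ℕ
  | 0 => 0
  | i + 1 => ρ i + 1

/-- Simultaneous renaming of variables. -/
def rename : (ℕ → ℕ) → Term → Term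
  | _, fail => fail
  | _, unit => unit
  | _, tt => tt
  | _, ff => ff
  | ρ, var i => var (ρ i)
  | _, loc l => loc l
  | ρ, lam M => lam (rename (upRen ρ) M)
  | ρ, app M₁ M₂ => app (rename ρ M₁) (rename ρ M₂)
  | ρ, fix M => fix (rename (upRen (upRen ρ)) M)
  | ρ, ite M₀ M₁ M₂ => ite (rename ρ M₀) (rename ρ M₁) (rename ρ M₂)
  | ρ, mkref M => mkref (rename ρ M)
  | ρ, deref M => deref (rename ρ M)
  | ρ, assign M₁ M₂ => assign (rename ρ M₁) (rename ρ M₂)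

/-- Lift a substitution under one binder. -/
def upSubst (s : ℕ → Term) : ℕ → Term
  | 0 => var 0
  | i + 1 => rename Nat.succ (s i)

/-- Simultaneous capture-avoiding substitution. -/
def subst : (ℕ → Term) → Term → Term
  | _, fail => fail
  | _, unit => unit
  | _, tt => tt
  | _, ff => ff
  | s, var i => s i
  | _, loc l => loc l
  | s, lam M => lam (subst (upSubst s) M)
  | s, app M₁ M₂ => app (subst s M₁) (subst s M₂)
  | s, fix M => fix (subst (upSubst (upSubst s)) M)
  | s, ite M₀ M₁ M₂ => ite (subst s M₀) (subst s M₁) (subst s M₂)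
  | s, mkref M => mkref (subst s M)
  | s, deref M => deref (subst s M)
  | s, assign M₁ M₂ => assign (subst s M₁) (subst s M₂)

/-- The substitution sending variable `0` to `N` and variable `i + 1` to variable `i`. -/
def single (N : Term) : ℕ → Term
  | 0 => N
  | i + 1 => var i

/-- `[N/x] M`, where `x` is the variable `0` of `M`. -/
def inst (M N : Term) : Term := subst (single N) M

/-- The expression denoting a Boolean constant. -/
def ofBool : Bool → Term
  | true => tt
  | false => ff

/-- Values: unit, the Boolean constants, abstractions and (at run time) locations. -/
inductive IsValue : Term → Prop
  | unit : IsValue unit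
  | tt : IsValue tt
  | ff : IsValue ff
  | lam (M : Term) : IsValue (lam M)
  | loc (l : ℕ) : IsValue (loc l)

end Term

/-- Call-by-value evaluation contexts
`E ::= [] | E M | V E | if E then M₁ else M₂ | ref E | !E | E := M | ℓ := E`. -/
inductive Ctx : Type
  | hole
  | appL (E : Ctx) (M : Term)
  | appR (V : Term) (hV : V.IsValue) (E : Ctx)
  | ite (E : Ctx) (M₁ M₂ : Term)
  | mkref (E : Ctx)
  | deref (E : Ctx)
  | assignL (E : Ctx) (M : Term)
  | assignR (l : ℕ) (E : Ctx)

/-- `E.fill M` is `E[M]`. -/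
def Ctx.fill : Ctx → Term → Term
  | hole, N => N
  | appL E M, N => Term.app (E.fill N) M
  | appR V _ E, N => Term.app V (E.fill N)
  | ite E M₁ M₂, N => Term.ite (E.fill N) M₁ M₂
  | mkref E, N => Term.mkref (E.fill N)
  | deref E, N => Term.deref (E.fill N)
  | assignL E M, N => Term.assign (E.fill N) M
  | assignR l E, N => Term.assign (Term.loc l) (E.fill N)

/-- A store: the `l`-th entry is the content of location `l`,
and the allocated locations are those below the length. -/
abbrev Store : Type := List Bool

/-- The one-step call-by-value reduction on pairs of an expression and a store. -/
inductive Step : Term × Store → Term × Store → Prop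
  | beta (E : Ctx) (M V : Term) (μ : Store) : V.IsValue →
      Step (E.fill (Term.app (Term.lam M) V), μ) (E.fill (M.inst V), μ)
  | iteTrue (E : Ctx) (M₁ M₂ : Term) (μ : Store) :
      Step (E.fill (Term.ite Term.tt M₁ M₂), μ) (E.fill M₁, μ)
  | iteFalse (E : Ctx) (M₁ M₂ : Term) (μ : Store) :
      Step (E.fill (Term.ite Term.ff M₁ M₂), μ) (E.fill M₂, μ)
  | fail (E : Ctx) (μ : Store) : Step (E.fill Term.fail, μ) (Term.fail, μ)
  /- `Y (λ f. λ x. M)` steps to `λ x. [Y (λ f. λ x. M) / f] M` -/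
  | fix (E : Ctx) (M : Term) (μ : Store) :
      Step (E.fill (Term.fix M), μ)
        (E.fill (Term.lam (M.subst (Term.upSubst (Term.single (Term.fix M))))), μ)
  /- allocation of a fresh location, initialized with `b` -/
  | mkref (E : Ctx) (b : Bool) (μ : Store) :
      Step (E.fill (Term.mkref (Term.ofBool b)), μ) (E.fill (Term.loc μ.length), μ ++ [b])
  | deref (E : Ctx) (l : ℕ) (b : Bool) (μ : Store) : μ[l]? = some b →
      Step (E.fill (Term.deref (Term.loc l)), μ) (E.fill (Term.ofBool b), μ)
  | assign (E : Ctx) (l : ℕ) (b : Bool) (μ : Store) : l < μ.length →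
      Step (E.fill (Term.assign (Term.loc l) (Term.ofBool b)), μ)
        (E.fill Term.unit, μ.set l b)

/-- `M` reduces, from the empty store, to `FAIL` in zero or more steps. -/
def Reaches (M : Term) : Prop :=
  ∃ μ : Store, Relation.ReflTransGen Step (M, []) (Term.fail, μ)

/-- The instances of the reachability problem: closed expressions of some base type. -/
def IsInstance (M : Term) : Prop := ∃ b : BaseTy, HasType [] M (Ty.base b)

namespace Term

/-- An explicit Gödel numbering of expressions. -/
def code : Term → ℕ
  | fail => 0
  | unit => 1
  | tt => 2
  | ff => 3
  | var i => 9 * i + 4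
  | loc l => 9 * l + 5
  | lam M => 9 * M.code + 6
  | app M₁ M₂ => 9 * Nat.pair M₁.code M₂.code + 7
  | fix M => 9 * M.code + 8
  | ite M₀ M₁ M₂ => 9 * Nat.pair M₀.code (Nat.pair M₁.code M₂.code) + 9
  | mkref M => 9 * M.code + 10
  | deref M => 9 * M.code + 11
  | assign M₁ M₂ => 9 * Nat.pair M₁.code M₂.code + 12

/-- The inverse of the numbering `code`. -/
def ofCode : ℕ → Term
  | 0 => fail
  | 1 => unit
  | 2 => tt
  | 3 => ff
  | n + 4 =>
    let m := n / 9
    have hm : m < n + 4 := lt_of_le_of_lt (Nat.div_le_self n 9) (by omega)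
    have h1 : m.unpair.1 < n + 4 := lt_of_le_of_lt m.unpair_left_le hm
    have h2 : m.unpair.2 < n + 4 := lt_of_le_of_lt m.unpair_right_le hm
    have h3 : m.unpair.2.unpair.1 < n + 4 := lt_of_le_of_lt m.unpair.2.unpair_left_le h2
    have h4 : m.unpair.2.unpair.2 < n + 4 := lt_of_le_of_lt m.unpair.2.unpair_right_le h2
    match n % 9 with
    | 0 => var m
    | 1 => loc m
    | 2 => lam (ofCode m)
    | 3 => app (ofCode m.unpair.1) (ofCode m.unpair.2)
    | 4 => fix (ofCode m)
    | 5 => ite (ofCode m.unpair.1) (ofCode m.unpair.2.unpair.1) (ofCode m.unpair.2.unpair.2)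
    | 6 => mkref (ofCode m)
    | 7 => deref (ofCode m)
    | _ => assign (ofCode m.unpair.1) (ofCode m.unpair.2)
termination_by n => n
decreasing_by
  all_goals first
    | exact hm
    | exact h1
    | exact h2
    | exact h3
    | exact h4

theorem ofCode_code (M : Term) : ofCode M.code = M := by
  have hdiv : ∀ a r : ℕ, r < 9 → (9 * a + r) / 9 = a := fun a r h => by omega
  have hmod : ∀ a r : ℕ, r < 9 → (9 * a + r) % 9 = r := fun a r h => by omega
  have key : ∀ a r : ℕ, 9 * a + (r + 4) = (9 * a + r) + 4 := fun a r => by omega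
  induction M with
  | fail => simp [code, ofCode]
  | unit => simp [code, ofCode]
  | tt => simp [code, ofCode]
  | ff => simp [code, ofCode]
  | var i => rw [code, key i 0, ofCode]; simp [hdiv, hmod]
  | loc i => rw [code, key i 1, ofCode]; simp [hdiv, hmod]
  | lam M ih => rw [code, key _ 2, ofCode]; simp [hdiv, hmod, ih]
  | app M N ih₁ ih₂ => rw [code, key _ 3, ofCode]; simp [hdiv, hmod, ih₁, ih₂]
  | fix M ih => rw [code, key _ 4, ofCode]; simp [hdiv, hmod, ih]
  | ite L M N ih₀ ih₁ ih₂ => rw [code, key _ 5, ofCode]; simp [hdiv, hmod, ih₀, ih₁, ih₂]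
  | mkref M ih => rw [code, key _ 6, ofCode]; simp [hdiv, hmod, ih]
  | deref M ih => rw [code, key _ 7, ofCode]; simp [hdiv, hmod, ih]
  | assign M N ih₁ ih₂ => rw [code, key _ 8, ofCode]; simp [hdiv, hmod, ih₁, ih₂]

theorem code_ofCode (n : ℕ) : (ofCode n).code = n := by
  induction n using Nat.strong_induction_on with
  | _ n ih =>
    match n, ih with
    | 0, _ => simp [ofCode, code]
    | 1, _ => simp [ofCode, code]
    | 2, _ => simp [ofCode, code]
    | 3, _ => simp [ofCode, code]
    | n + 4, ih =>
      have hm : n / 9 < n + 4 := lt_of_le_of_lt (Nat.div_le_self n 9) (by omega)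
      have h1 := lt_of_le_of_lt (n / 9).unpair_left_le hm
      have h2 := lt_of_le_of_lt (n / 9).unpair_right_le hm
      have h3 := lt_of_le_of_lt (n / 9).unpair.2.unpair_left_le h2
      have h4 := lt_of_le_of_lt (n / 9).unpair.2.unpair_right_le h2
      rw [ofCode]
      have hr : n % 9 < 9 := Nat.mod_lt _ (by norm_num)
      have hn : 9 * (n / 9) + n % 9 = n := Nat.div_add_mod n 9
      generalize n % 9 = r at hr hn
      interval_cases r <;>
        simp only [code, ih _ hm, ih _ h1, ih _ h2, ih _ h3, ih _ h4, Nat.pair_unpair] <;> omega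

/-- The numbering as a bijection with the natural numbers; it determines what it means for a
function on expressions to be computable. -/
instance instDenumerable : Denumerable Term :=
  Denumerable.mk' ⟨code, ofCode, ofCode_code, code_ofCode⟩

end Term

/-- The reachability problem is decidable: some algorithm halts with the correct answer on every
instance of the problem (nothing is required of it on other inputs). -/
def ReachabilityDecidable : Prop :=
  ∃ f : Term →. Bool, Partrec f ∧
    ∀ M : Term, IsInstance M → ∃ a ∈ f M, (a = true ↔ Reaches M)

end BPCFR

/-!
The number `n` is represented by a closed value `num n : unit → unit → bool` that contains no
locations: every call `num n ()` allocates `n` Boolean cells and returns an iterator that answers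
`true` exactly `n` times, one cell being consumed per answer. As a number has no state of its own,
it can be used any number of times, and evaluating an expression that computes with numbers only
extends the store. Composition is therefore `let`, a primitive recursion is a tail-recursive loop
driven by one iterator for its recursion argument, and minimization is an upward search. So every
partial recursive function is computed by an expression.

Now let `u` be a partial recursive predicate that agrees somewhere with every partial recursive
predicate, by diagonalization. The expressions that fail when `u n` is true and return `()` when
`u n` is false, hence cannot fail since reduction is deterministic, depend computably on `n`; the
negated answers of a decision procedure on them would form a partial recursive predicate that
disagrees with `u` everywhere.
-/

namespace BPCFR

namespace Term

/-! ### Substitution -/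

/-- The environment that sends the variable `0` to `V` and is `s` on the remaining variables. -/
def scons (V : Term) (s : ℕ → Term) : ℕ → Term
  | 0 => V
  | i + 1 => s i

theorem upRen_id : upRen id = id := by
  funext i; cases i <;> rfl

theorem rename_id (M : Term) : M.rename id = M := by
  induction M <;> simp_all [rename, upRen_id]

theorem upRen_comp_upRen (ρ ρ' : ℕ → ℕ) : upRen ρ' ∘ upRen ρ = upRen (ρ' ∘ ρ) := by
  funext i; cases i <;> rfl

theorem rename_rename (M : Term) (ρ ρ' : ℕ → ℕ) :
    (M.rename ρ).rename ρ' = M.rename (ρ' ∘ ρ) := by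
  induction M generalizing ρ ρ' <;> simp_all [rename, upRen_comp_upRen]

theorem upSubst_comp_upRen (ρ : ℕ → ℕ) (t : ℕ → Term) :
    upSubst t ∘ upRen ρ = upSubst (t ∘ ρ) := by
  funext i; cases i <;> rfl

theorem subst_rename (M : Term) (ρ : ℕ → ℕ) (t : ℕ → Term) :
    (M.rename ρ).subst t = M.subst (t ∘ ρ) := by
  induction M generalizing ρ t <;> simp_all [rename, subst, upSubst_comp_upRen]

theorem rename_comp_upSubst (s : ℕ → Term) (ρ : ℕ → ℕ) :
    rename (upRen ρ) ∘ upSubst s = upSubst (rename ρ ∘ s) := by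
  funext i
  cases i with
  | zero => rfl
  | succ i => simp only [Function.comp, upSubst, rename_rename]; rfl

theorem rename_subst (M : Term) (s : ℕ → Term) (ρ : ℕ → ℕ) :
    (M.subst s).rename ρ = M.subst (rename ρ ∘ s) := by
  induction M generalizing ρ s <;> simp_all [rename, subst, rename_comp_upSubst]

theorem subst_comp_upSubst (s t : ℕ → Term) :
    subst (upSubst t) ∘ upSubst s = upSubst (subst t ∘ s) := by
  funext i
  cases i with
  | zero => rfl
  | succ i => simp only [Function.comp, upSubst, subst_rename, rename_subst]; rfl

theorem subst_subst (M : Term) (s t : ℕ → Term) :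
    (M.subst s).subst t = M.subst (subst t ∘ s) := by
  induction M generalizing s t <;> simp_all [subst, subst_comp_upSubst]

theorem upSubst_var : upSubst var = var := by
  funext i; cases i <;> rfl

theorem subst_var (M : Term) : M.subst var = M := by
  induction M <;> simp_all [subst, upSubst_var]

theorem subst_single_comp_upSubst (s : ℕ → Term) (V : Term) :
    subst (single V) ∘ upSubst s = scons V s := by
  funext i
  cases i with
  | zero => rfl
  | succ i => exact (subst_rename _ _ _).trans (subst_var _)

theorem inst_subst_upSubst (M : Term) (s : ℕ → Term) (V : Term) :
    (M.subst (upSubst s)).inst V = M.subst (scons V s) := by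
  rw [inst, subst_subst, subst_single_comp_upSubst]

theorem subst_upSubst_upSubst_single (M : Term) (s : ℕ → Term) (V : Term) :
    (M.subst (upSubst (upSubst s))).subst (upSubst (single V)) =
      M.subst (upSubst (scons V s)) := by
  rw [subst_subst, subst_comp_upSubst, subst_single_comp_upSubst]

/-- `let x = A in B`, where `x` is the variable `0` of `B`. -/
def mlet (A B : Term) : Term := app (lam B) A

/-- Binds the values of the expressions `G 0, …, G (m - 1)`, all of which live outside of the
binders, to the variables `0, …, m - 1` of `B`. -/
def letAll : {m : ℕ} → (Fin m → Term) → Term → Term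
  | 0, _, B => B
  | m + 1, G, B => letAll (Fin.tail G) (mlet ((G 0).rename (· + m)) B)

end Term

open Term

/-! ### Typing -/

theorem getElem?_upRen {Γ Δ : List Ty} {ρ : ℕ → ℕ}
    (h : ∀ i τ, Γ[i]? = some τ → Δ[ρ i]? = some τ) (σ : Ty) :
    ∀ i τ, (σ :: Γ)[i]? = some τ → (σ :: Δ)[upRen ρ i]? = some τ
  | 0, _, hi => hi
  | i + 1, τ, hi => h i τ hi

namespace HasType

theorem rename {Γ Δ : List Ty} {M : Term} {τ : Ty} {ρ : ℕ → ℕ} (hM : HasType Γ M τ)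
    (h : ∀ i τ, Γ[i]? = some τ → Δ[ρ i]? = some τ) : HasType Δ (M.rename ρ) τ := by
  induction hM generalizing Δ ρ with
  | fail => exact .fail
  | unit => exact .unit
  | tt => exact .tt
  | ff => exact .ff
  | var hi => exact .var (h _ _ hi)
  | lam _ ih => exact .lam (ih (getElem?_upRen h _))
  | app _ _ ih₁ ih₂ => exact .app (ih₁ h) (ih₂ h)
  | fix _ ih => exact .fix (ih (getElem?_upRen (getElem?_upRen h _) _))
  | ite _ _ _ ih₀ ih₁ ih₂ => exact .ite (ih₀ h) (ih₁ h) (ih₂ h)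
  | mkref _ ih => exact .mkref (ih h)
  | deref _ ih => exact .deref (ih h)
  | assign _ _ ih₁ ih₂ => exact .assign (ih₁ h) (ih₂ h)

theorem mlet {Γ : List Ty} {A B : Term} {σ τ : Ty} (hA : HasType Γ A σ)
    (hB : HasType (σ :: Γ) B τ) : HasType Γ (mlet A B) τ :=
  .app (.lam hB) hA

theorem letAll {Γ : List Ty} {σ τ : Ty} {m : ℕ} {G : Fin m → Term} {B : Term}
    (hG : ∀ k, HasType Γ (G k) σ) (hB : HasType (List.replicate m σ ++ Γ) B τ) :
    HasType Γ (letAll G B) τ := by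
  induction m generalizing B with
  | zero => exact hB
  | succ m ih =>
    refine ih (fun k => hG k.succ) (.mlet ((hG 0).rename fun i τ hi => ?_) hB)
    simpa [List.getElem?_append_right] using hi

end HasType

/-! ### Determinism -/

/-- The result of a step below the context `K`, given its result in the empty context; see
`headNext` for the encoding of results. -/
def frame (K : Term → Term) : Option (Option Term × Store) → Option (Option Term × Store) :=
  Option.map (Prod.map (Option.map K) id)

/-- Reduction of a redex in the empty evaluation context. The result `some (none, μ)` stands for a
failure, which discards the surrounding context, and `none` for the absence of a step. -/
def headNext : Term → Store → Option (Option Term × Store)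
  | fail, μ => some (none, μ)
  | app (lam M) V, μ => some (some (M.inst V), μ)
  | fix M, μ => some (some (lam (M.subst (upSubst (single (fix M))))), μ)
  | .ite tt M _, μ => some (some M, μ)
  | .ite ff _ N, μ => some (some N, μ)
  | mkref tt, μ => some (some (loc μ.length), μ ++ [true])
  | mkref ff, μ => some (some (loc μ.length), μ ++ [false])
  | deref (loc l), μ => (μ[l]?).map fun b => (some (ofBool b), μ)
  | assign (loc l) tt, μ => some (some unit, μ.set l true)
  | assign (loc l) ff, μ => some (some unit, μ.set l false)
  | _, _ => none

/-- The one-step reduction as a partial function, with results encoded as for `headNext`.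
It may also be defined on stuck expressions. -/
def next (M : Term) (μ : Store) : Option (Option Term × Store) :=
  match M with
  | app A B =>
    frame (app · B) (next A μ) <|> frame (app A) (next B μ) <|> headNext (app A B) μ
  | .ite A B C => frame (.ite · B C) (next A μ) <|> headNext (.ite A B C) μ
  | mkref A => frame mkref (next A μ) <|> headNext (mkref A) μ
  | deref A => frame deref (next A μ) <|> headNext (deref A) μ
  | assign A B =>
    frame (assign · B) (next A μ) <|> frame (assign A) (next B μ) <|> headNext (assign A B) μ
  | M => headNext M μ

theorem next_of_isValue {V : Term} (hV : V.IsValue) (μ : Store) : next V μ = none := by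
  cases hV <;> rfl

theorem next_fill (E : Ctx) {M : Term} {μ μ' : Store} {r : Option Term}
    (h : next M μ = some (r, μ')) : next (E.fill M) μ = some (r.map E.fill, μ') := by
  induction E with
  | hole => rw [show Ctx.hole.fill = id from rfl, Option.map_id]; exact h
  | appR V hV E ih => simp [Ctx.fill, next, next_of_isValue hV, ih, frame, Function.comp_def]
  | assignR l E ih => simp [Ctx.fill, next, headNext, ih, frame, Function.comp_def]
  | _ => simp_all [Ctx.fill, next, frame, Function.comp_def]

theorem next_of_step {a b : Term × Store} (h : Step a b) :
    ∃ r : Option Term, next a.1 a.2 = some (r, b.2) ∧ r.getD fail = b.1 := by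
  cases h with
  | beta E M V μ hV =>
    exact ⟨_, next_fill E (r := some (M.inst V)) (by
      simp [next, next_of_isValue hV, frame, headNext]), rfl⟩
  | iteTrue E M N μ => exact ⟨_, next_fill E (r := some M) rfl, rfl⟩
  | iteFalse E M N μ => exact ⟨_, next_fill E (r := some N) rfl, rfl⟩
  | fail E μ => exact ⟨_, next_fill E (r := none) rfl, rfl⟩
  | fix E M μ => exact ⟨_, next_fill E (r := some _) rfl, rfl⟩
  | mkref E b μ => exact ⟨_, next_fill E (r := some (loc μ.length)) (by cases b <;> rfl), rfl⟩
  | deref E l b μ hl =>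
    exact ⟨_, next_fill E (r := some (ofBool b)) (by simp [next, headNext, frame, hl]), rfl⟩
  | assign E l b μ hl => exact ⟨_, next_fill E (r := some unit) (by cases b <;> rfl), rfl⟩

theorem Step.deterministic {a b c : Term × Store} (hb : Step a b) (hc : Step a c) : b = c := by
  obtain ⟨r, hr, hrb⟩ := next_of_step hb
  obtain ⟨r', hr', hrc⟩ := next_of_step hc
  obtain ⟨rfl, hμ⟩ := Prod.mk.inj (Option.some.inj (hr.symm.trans hr'))
  exact Prod.ext (hrb.symm.trans hrc) hμ

theorem Term.IsValue.not_step {V : Term} (hV : V.IsValue) {μ : Store} {c : Term × Store} :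
    ¬ Step (V, μ) c := fun h => by
  obtain ⟨r, hr, -⟩ := next_of_step h
  simp [next_of_isValue hV] at hr

theorem eq_of_reflTransGen_step_fail {μ : Store} {c : Term × Store}
    (h : Relation.ReflTransGen Step (fail, μ) c) : c = (fail, μ) := by
  induction h with
  | refl => rfl
  | tail _ hstep ih => subst ih; exact hstep.deterministic (.fail .hole μ)

theorem not_reaches_of_isValue {M V : Term} {μ : Store} (hV : V.IsValue)
    (h : Relation.ReflTransGen Step (M, []) (V, μ)) : ¬ Reaches M := by
  rintro ⟨μ', hfail⟩
  have hne : V ≠ fail := by rintro rfl; cases hV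
  rcases Relation.ReflTransGen.total_of_right_unique (r := Step)
    (fun _ _ _ h₁ h₂ => h₁.deterministic h₂) h hfail with hVf | hfV
  · rcases hVf.cases_head with heq | ⟨c, hstep, -⟩
    · exact hne (congrArg Prod.fst heq)
    · exact hV.not_step hstep
  · exact hne (congrArg Prod.fst (eq_of_reflTransGen_step_fail hfV))

/-! ### Evaluation in environments -/

/-- Composition of evaluation contexts. -/
def Ctx.comp : Ctx → Ctx → Ctx
  | .hole, F => F
  | .appL E M, F => .appL (E.comp F) M
  | .appR V hV E, F => .appR V hV (E.comp F)
  | .ite E M N, F => .ite (E.comp F) M N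
  | .mkref E, F => .mkref (E.comp F)
  | .deref E, F => .deref (E.comp F)
  | .assignL E M, F => .assignL (E.comp F) M
  | .assignR l E, F => .assignR l (E.comp F)

theorem Ctx.fill_comp (E F : Ctx) (M : Term) : (E.comp F).fill M = E.fill (F.fill M) := by
  induction E <;> simp_all [Ctx.comp, Ctx.fill]

/-- In every evaluation context, `M` with store `μ` reduces to `V` with store `μ'`. -/
def Evals (M : Term) (μ : Store) (V : Term) (μ' : Store) : Prop :=
  ∀ E : Ctx, Relation.ReflTransGen Step (E.fill M, μ) (E.fill V, μ')

namespace Evals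

variable {A B M N V W : Term} {μ μ₁ μ₂ μ₃ : Store} {s t : ℕ → Term}

theorem refl (M : Term) (μ : Store) : Evals M μ M μ := fun _ => .refl

theorem trans (h₁ : Evals A μ B μ₁) (h₂ : Evals B μ₁ V μ₂) : Evals A μ V μ₂ :=
  fun E => (h₁ E).trans (h₂ E)

theorem fill (F : Ctx) (h : Evals A μ V μ₁) : Evals (F.fill A) μ (F.fill V) μ₁ := fun E => by
  simpa only [Ctx.fill_comp] using h (E.comp F)

theorem app (hA : Evals A μ (lam (M.subst (upSubst t))) μ₁) (hB : Evals B μ₁ V μ₂)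
    (hV : V.IsValue) (hM : Evals (M.subst (scons V t)) μ₂ W μ₃) :
    Evals (app A B) μ W μ₃ :=
  (hA.fill (.appL .hole B)).trans <|
    (hB.fill (.appR _ (.lam _) .hole)).trans <|
      trans (fun E => .single (.beta E _ _ _ hV)) (by rwa [inst_subst_upSubst])

theorem ite_true (hA : Evals A μ tt μ₁) (hM : Evals M μ₁ V μ₂) : Evals (ite A M N) μ V μ₂ :=
  (hA.fill (.ite .hole M N)).trans <| trans (fun E => .single (.iteTrue E _ _ _)) hM

theorem ite_false (hA : Evals A μ ff μ₁) (hN : Evals N μ₁ V μ₂) : Evals (ite A M N) μ V μ₂ :=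
  (hA.fill (.ite .hole M N)).trans <| trans (fun E => .single (.iteFalse E _ _ _)) hN

theorem fix (M : Term) (s : ℕ → Term) (μ : Store) :
    Evals ((fix M).subst s) μ (lam (M.subst (upSubst (scons ((fix M).subst s) s)))) μ :=
  fun E => .single (by rw [← subst_upSubst_upSubst_single]; exact .fix E _ μ)

theorem app_fix (hB : Evals B μ V μ₁) (hV : V.IsValue)
    (hM : Evals (M.subst (scons V (scons ((Term.fix M).subst s) s))) μ₁ W μ₂) :
    Evals (Term.app ((Term.fix M).subst s) B) μ W μ₂ :=
  app (fix M s μ) hB hV hM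

theorem mlet (hA : Evals (A.subst s) μ V μ₁) (hV : V.IsValue)
    (hB : Evals (B.subst (scons V s)) μ₁ W μ₂) : Evals ((mlet A B).subst s) μ W μ₂ :=
  app (refl _ _) hA hV hB

theorem mkref_true (μ : Store) : Evals (mkref tt) μ (loc μ.length) (μ ++ [true]) :=
  fun E => .single (.mkref E true μ)

theorem deref_length (μ ν : Store) (b : Bool) :
    Evals (deref (loc μ.length)) (μ ++ b :: ν) (ofBool b) (μ ++ b :: ν) :=
  fun E => .single (.deref E _ _ _ (by simp))

theorem assign_false_length (μ ν : Store) (b : Bool) :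
    Evals (assign (loc μ.length) ff) (μ ++ b :: ν) unit (μ ++ false :: ν) := fun E => by
  simpa [ofBool] using Relation.ReflTransGen.single
    (Step.assign E μ.length false (μ ++ b :: ν) (by simp))

end Evals

/-- From every store, `M` reduces to `V` and extends the store without changing it. -/
def Yields (M V : Term) : Prop :=
  ∀ μ : Store, ∃ ν : Store, Evals M μ V (μ ++ ν)

namespace Yields

variable {A B M N V W : Term} {s : ℕ → Term}

theorem of_evals (h : ∀ μ, Evals M μ V μ) : Yields M V := fun μ => ⟨[], by simpa using h μ⟩

theorem refl (M : Term) : Yields M M := of_evals (.refl M)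

theorem trans (h₁ : Yields A B) (h₂ : Yields B V) : Yields A V := fun μ => by
  obtain ⟨ν, h₁⟩ := h₁ μ
  obtain ⟨ν', h₂⟩ := h₂ (μ ++ ν)
  exact ⟨ν ++ ν', by simpa using h₁.trans h₂⟩

theorem fill (F : Ctx) (h : Yields A V) : Yields (F.fill A) (F.fill V) := fun μ =>
  (h μ).imp fun _ h => h.fill F

theorem app (hB : Yields B V) (hV : V.IsValue) (hM : Yields (M.subst (scons V s)) W) :
    Yields (app (lam (M.subst (upSubst s))) B) W :=
  (hB.fill (.appR _ (.lam _) .hole)).trans <|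
    (of_evals fun _ => .app (.refl _ _) (.refl _ _) hV (.refl _ _)).trans hM

theorem app_fix (hB : Yields B V) (hV : V.IsValue)
    (hM : Yields (M.subst (scons V (scons ((fix M).subst s) s))) W) :
    Yields (Term.app ((fix M).subst s) B) W :=
  (of_evals fun _ => (Evals.fix M s _).fill (.appL .hole B)).trans (app hB hV hM)

theorem mlet (hA : Yields (A.subst s) V) (hV : V.IsValue)
    (hB : Yields (B.subst (scons V s)) W) : Yields ((mlet A B).subst s) W :=
  app hA hV hB

theorem ite_true (hA : Yields A tt) (hM : Yields M V) : Yields (ite A M N) V :=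
  (hA.fill (.ite .hole M N)).trans <| (of_evals fun _ => .ite_true (.refl _ _) (.refl _ _)).trans hM

theorem ite_false (hA : Yields A ff) (hN : Yields N V) : Yields (ite A M N) V :=
  (hA.fill (.ite .hole M N)).trans <|
    (of_evals fun _ => .ite_false (.refl _ _) (.refl _ _)).trans hN

theorem letAll {m : ℕ} {G W : Fin m → Term} (hG : ∀ k, Yields ((G k).subst s) (W k))
    (hW : ∀ k, (W k).IsValue)
    (hB : ∀ t : ℕ → Term, (∀ k : Fin m, t k = W k) → (∀ i, t (i + m) = s i) →
      Yields (B.subst t) V) :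
    Yields ((letAll G B).subst s) V := by
  induction m generalizing B with
  | zero => exact hB s (fun k => k.elim0) fun _ => rfl
  | succ m ih =>
    refine ih (fun k => hG k.succ) (fun k => hW k.succ) fun t ht hts => ?_
    have hG₀ : ((G 0).rename (· + m)).subst t = (G 0).subst s := by
      rw [subst_rename, show t ∘ (· + m) = s from funext hts]
    exact .mlet (hG₀ ▸ hG 0) (hW 0) (hB _ (Fin.cases rfl ht) hts)

end Yields

/-! ### Numbers -/

/-- The type of numbers, which are represented by generators of iterators. -/
abbrev Num : Ty := .fn (.base .unit) (.fn (.base .unit) (.base .bool))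

/-- A call of the iterator with first cell `1` that continues with the iterator `2`: if the cell
contains `true`, it is consumed. -/
def iterBody : Term :=
  ite (deref (var 1)) (mlet (assign (var 1) ff) tt) (app (var 2) unit)

/-- A call of the successor of a number, given a fresh iterator `0` for the latter. -/
def succBody : Term := mlet (mkref tt) (lam iterBody)

/-- The successor of the number `0`. -/
def succNum : Term := lam (mlet (app (var 1) unit) succBody)

/-- The numeral for `n`: a call of it returns a fresh iterator that answers `true` `n` times. -/
def num : ℕ → Term
  | 0 => lam (lam ff)
  | n + 1 => lam (mlet (app (num n) unit) succBody)

/-- The iterator with cells at the locations `b, …, b + n - 1`, which are consumed from the last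
one down. -/
def iter (b : ℕ) : ℕ → Term
  | 0 => lam ff
  | n + 1 => (lam iterBody).subst (scons (loc (b + n)) (scons (iter b n) var))

/-- The test whether the value of `M` is a number other than `0`. -/
def isPos (M : Term) : Term := app (app M unit) unit

theorem isValue_num (n : ℕ) : (num n).IsValue := by cases n <;> exact .lam _

theorem isValue_iter (b n : ℕ) : (iter b n).IsValue := by cases n <;> exact .lam _

theorem rename_num (n : ℕ) (ρ : ℕ → ℕ) : (num n).rename ρ = num n := by
  induction n generalizing ρ with
  | zero => rfl
  | succ n ih => simp [num, mlet, succBody, iterBody, rename, upRen, ih]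

theorem subst_succNum {s : ℕ → Term} {n : ℕ} (hs : s 0 = num n) :
    succNum.subst s = num (n + 1) := by
  simp [num, succNum, mlet, succBody, iterBody, subst, upSubst, rename, hs, rename_num]

theorem subst_lam_iterBody {s : ℕ → Term} {b n : ℕ} (hcell : s 0 = loc (b + n))
    (hrest : s 1 = iter b n) : (lam iterBody).subst s = iter b (n + 1) := by
  simp [iter, mlet, iterBody, subst, upSubst, rename, scons, hcell, hrest]

theorem hasType_succBody (Γ : List Ty) :
    HasType (.fn (.base .unit) (.base .bool) :: Γ) succBody (.fn (.base .unit) (.base .bool)) :=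
  .mlet (.mkref .tt) <| .lam <|
    .ite (.deref (.var rfl)) (.mlet (.assign (.var rfl) .ff) .tt) (.app (.var rfl) .unit)

theorem hasType_succNum (Γ : List Ty) : HasType (Num :: Γ) succNum Num :=
  .lam (.mlet (.app (.var rfl) .unit) (hasType_succBody _))

theorem hasType_num (Γ : List Ty) (n : ℕ) : HasType Γ (num n) Num := by
  induction n generalizing Γ with
  | zero => exact .lam (.lam .ff)
  | succ n ih => exact .lam (.mlet (.app (ih _) .unit) (hasType_succBody _))

theorem HasType.isPos {Γ : List Ty} {M : Term} (hM : HasType Γ M Num) :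
    HasType Γ (isPos M) (.base .bool) :=
  .app (.app hM .unit) .unit

theorem evals_app_num (n : ℕ) (μ : Store) :
    Evals (app (num n) unit) μ (iter μ.length n) (μ ++ List.replicate n true) := by
  induction n with
  | zero =>
    exact .app (t := var) (M := lam ff) (.refl _ _) (.refl _ _) .unit (by simpa using .refl _ _)
  | succ n ih =>
    rw [← subst_succNum (s := single (num n)) rfl, List.replicate_succ', ← List.append_assoc]
    refine .app (.refl _ _) (.refl _ _) .unit <| .mlet ih (isValue_iter _ _) <|
      .mlet (.mkref_true _) (.loc _) ?_
    rw [subst_lam_iterBody (n := n) (by simp [scons]) rfl]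
    exact .refl _ _

section Iterator

variable {b n : ℕ} {μ : Store}

theorem evals_app_iter_of_cell_true (hμ : μ.length = b + n) (ν : Store) :
    Evals (app (iter b (n + 1)) unit) (μ ++ true :: ν) tt (μ ++ false :: ν) := by
  refine .app (.refl _ _) (.refl _ _) .unit (.ite_true (μ₁ := μ ++ true :: ν) ?_
    (.mlet ?_ .unit (.refl _ _)))
  · simpa only [subst, scons, hμ, ofBool] using Evals.deref_length μ ν true
  · simpa only [subst, scons, hμ] using Evals.assign_false_length μ ν true

theorem evals_app_iter_of_cell_false (hμ : μ.length = b + n) (ν : Store) :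
    Evals (app (iter b (n + 1)) unit) (μ ++ false :: ν)
      (app (iter b n) unit) (μ ++ false :: ν) := by
  refine .app (.refl _ _) (.refl _ _) .unit (.ite_false ?_ (.refl _ _))
  simpa only [subst, scons, hμ, ofBool] using Evals.deref_length μ ν false

theorem evals_app_iter_skip (hμ : μ.length = b + n) (j : ℕ) (ν : Store) :
    Evals (app (iter b (n + j)) unit) (μ ++ (List.replicate j false ++ ν))
      (app (iter b n) unit) (μ ++ (List.replicate j false ++ ν)) := by
  induction j generalizing ν with
  | zero => exact .refl _ _
  | succ j ih =>
    have hskip := evals_app_iter_of_cell_false (b := b) (n := n + j)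
      (μ := μ ++ List.replicate j false) (by simp [hμ, add_assoc]) ν
    simp only [List.replicate_succ', List.append_assoc, List.singleton_append] at hskip ⊢
    exact hskip.trans (ih _)

theorem evals_app_iter_zero (μ ν : Store) (j : ℕ) :
    Evals (app (iter μ.length j) unit) (μ ++ (List.replicate j false ++ ν)) ff
      (μ ++ (List.replicate j false ++ ν)) := by
  have hskip := evals_app_iter_skip (n := 0) (Nat.add_zero μ.length).symm j ν
  rw [Nat.zero_add] at hskip
  exact hskip.trans (.app (t := var) (M := ff) (.refl _ _) (.refl _ _) .unit (.refl _ _))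

theorem evals_app_iter_succ (μ ν : Store) (k j : ℕ) :
    Evals (app (iter μ.length (k + 1 + j)) unit)
      (μ ++ (List.replicate (k + 1) true ++ (List.replicate j false ++ ν))) tt
      (μ ++ (List.replicate k true ++ (List.replicate (j + 1) false ++ ν))) := by
  have hskip := evals_app_iter_skip (b := μ.length) (n := k + 1)
    (μ := μ ++ List.replicate (k + 1) true) (by simp) j ν
  have hcell := evals_app_iter_of_cell_true (b := μ.length) (n := k)
    (μ := μ ++ List.replicate k true) (by simp) (List.replicate j false ++ ν)
  rw [List.replicate_succ (n := j)]
  simp only [List.replicate_succ', List.append_assoc, List.cons_append] at hskip hcell ⊢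
  exact hskip.trans hcell

end Iterator

theorem Yields.isPos_zero {M : Term} (hM : Yields M (num 0)) : Yields (isPos M) ff :=
  (hM.fill (.appL (.appL .hole unit) unit)).trans fun μ =>
    ⟨[], ((evals_app_num 0 μ).fill (.appL .hole unit)).trans
      (by simpa [Ctx.fill] using evals_app_iter_zero μ [] 0)⟩

theorem Yields.isPos_succ {M : Term} {n : ℕ} (hM : Yields M (num (n + 1))) :
    Yields (isPos M) tt :=
  (hM.fill (.appL (.appL .hole unit) unit)).trans fun μ =>
    ⟨_, ((evals_app_num (n + 1) μ).fill (.appL .hole unit)).trans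
      (by simpa [Ctx.fill] using evals_app_iter_succ μ [] n 0)⟩

/-! ### Implementing functions on numbers -/

theorem get_mem_of_mem_mOfFn {α : Type*} {n : ℕ} {g : Fin n → Part α} {w : List.Vector α n}
    (h : w ∈ List.Vector.mOfFn g) (i : Fin n) : w.get i ∈ g i := by
  induction n with
  | zero => exact i.elim0
  | succ n ih =>
    simp only [List.Vector.mOfFn, Part.bind_eq_bind, Part.mem_bind_iff, Part.pure_eq_some,
      Part.mem_some_iff] at h
    obtain ⟨a, ha, w', hw', rfl⟩ := h
    cases i using Fin.cases with
    | zero => simpa using ha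
    | succ i => simpa using ih hw' i

/-- The expression `M`, in which the variables `0, …, n - 1` stand for the arguments, computes the
partial function `f`. Nothing is required of `M` where `f` is undefined. -/
structure Implements {n : ℕ} (M : Term) (f : List.Vector ℕ n →. ℕ) : Prop where
  hasType : HasType (List.replicate n Num) M Num
  yields : ∀ (s : ℕ → Term) (v : List.Vector ℕ n) (y : ℕ), (∀ i : Fin n, s i = num (v.get i)) →
    y ∈ f v → Yields (M.subst s) (num y)

/-- One round of the loop for a primitive recursion with step function `G`. The variables `0`, `1`,
`2` and `3` are the index, the current value, the loop and the iterator that drives it. The loop is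
called again, at the next index and value, for as long as the iterator answers `true`. -/
def precStep (G : Term) : Term :=
  ite (app (var 3) unit) (app (app (var 2) (G.rename (upRen (upRen (· + 3))))) succNum) (var 1)

/-- The body of the search for the least zero of `T`, as a function of the candidate: the variable
`0` is the candidate and `1` the search. -/
def searchStep (T : Term) : Term :=
  ite (isPos (T.rename (upRen (· + 1)))) (app (var 1) succNum) (var 0)

section

variable {n : ℕ} {v : List.Vector ℕ n} {s : ℕ → Term}

theorem evals_precStep {G : Term} {g : List.Vector ℕ (n + 2) →. ℕ} (hG : Implements G g)
    {r : ℕ → ℕ} (hr : ∀ j, r (j + 1) ∈ g (j ::ᵥ r j ::ᵥ v)) {μ : Store} (k j : ℕ) (ν : Store)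
    (hiter : s 0 = iter μ.length (k + j)) (hs : ∀ i : Fin n, s (i + 2) = num (v.get i)) :
    ∃ ν', Evals ((precStep G).subst
        (scons (num j) (scons (num (r j)) (scons ((fix (lam (precStep G))).subst s) s))))
      (μ ++ (List.replicate k true ++ (List.replicate j false ++ ν)))
      (num (r (k + j))) (μ ++ ν') := by
  induction k generalizing j ν with
  | zero =>
    rw [Nat.zero_add] at hiter ⊢
    have hanswer := evals_app_iter_zero μ ν j
    rw [← hiter] at hanswer
    exact ⟨_, .ite_false hanswer (.refl _ _)⟩
  | succ k ih =>
    have hanswer := evals_app_iter_succ μ ν k j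
    rw [← hiter] at hanswer
    have hvalue : Yields ((G.rename (upRen (upRen (· + 3)))).subst
        (scons (num j) (scons (num (r j)) (scons ((fix (lam (precStep G))).subst s) s))))
        (num (r (j + 1))) := by
      rw [subst_rename]
      exact hG.yields _ _ _ (Fin.cases rfl <| Fin.cases rfl hs) (hr j)
    obtain ⟨ν₁, hvalue⟩ :=
      hvalue (μ ++ (List.replicate k true ++ (List.replicate (j + 1) false ++ ν)))
    rw [show k + 1 + j = k + (j + 1) by omega] at hiter ⊢
    obtain ⟨ν₂, hloop⟩ := ih (j + 1) (ν ++ ν₁) hiter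
    refine ⟨ν₂, .ite_true hanswer (.app (.app_fix hvalue (isValue_num _) (.refl _ _))
      (.refl _ _) (.lam _) ?_)⟩
    rw [show succNum.subst (scons (num j) _) = num (j + 1) from subst_succNum rfl]
    simpa using hloop

theorem yields_searchStep {T : Term} {f : List.Vector ℕ (n + 1) →. ℕ} (hT : Implements T f)
    (hs : ∀ i : Fin n, s i = num (v.get i)) {k y : ℕ} (hky : k ≤ y) (hy : 0 ∈ f (y ::ᵥ v))
    (hlt : ∀ j < y, ∃ m, m + 1 ∈ f (j ::ᵥ v)) :
    Yields ((searchStep T).subst (scons (num k) (scons ((fix (searchStep T)).subst s) s)))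
      (num y) := by
  have htest (k m : ℕ) (hm : m ∈ f (k ::ᵥ v)) :
      Yields ((T.rename (upRen (· + 1))).subst
        (scons (num k) (scons ((fix (searchStep T)).subst s) s))) (num m) := by
    rw [subst_rename]
    exact hT.yields _ _ _ (Fin.cases rfl fun i => by simpa [upRen, scons] using hs i) hm
  induction hky using Nat.decreasingInduction with
  | self => exact .ite_false (.isPos_zero (htest y 0 hy)) (.refl _)
  | of_succ k hk ih =>
    obtain ⟨m, hm⟩ := hlt k hk
    refine .ite_true (.isPos_succ (htest k (m + 1) hm)) <|
      .app_fix (V := num (k + 1)) ?_ (isValue_num _) ih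
    rw [show succNum.subst (scons (num k) _) = num (k + 1) from subst_succNum rfl]
    exact .refl _

end

namespace Implements

variable {n : ℕ}

theorem zero : Implements (num 0) fun _ : List.Vector ℕ n => Part.some 0 where
  hasType := hasType_num _ 0
  yields s v y _ hy := by
    rw [Part.mem_some_iff.1 hy]
    exact .refl _

theorem succ : Implements succNum fun v : List.Vector ℕ 1 => Part.some (v.head + 1) where
  hasType := hasType_succNum _
  yields s v y hs hy := by
    rw [Part.mem_some_iff.1 hy, subst_succNum (n := v.head) (by simpa using hs 0)]
    exact .refl _

theorem var (i : Fin n) : Implements (var i) fun v => Part.some (v.get i) where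
  hasType := .var (by simp)
  yields s v y hs hy := by
    rw [Part.mem_some_iff.1 hy, subst, hs]
    exact .refl _

theorem comp {m : ℕ} {F : Term} {G : Fin n → Term} {f : List.Vector ℕ n →. ℕ}
    {g : Fin n → List.Vector ℕ m →. ℕ} (hF : Implements F f) (hG : ∀ i, Implements (G i) (g i)) :
    Implements (letAll G F) fun v => (List.Vector.mOfFn fun i => g i v) >>= f where
  hasType := .letAll (fun i => (hG i).hasType) <| by
    rw [← rename_id F]
    exact hF.hasType.rename fun i τ hi => by grind
  yields s v y hs hy := by
    obtain ⟨w, hw, hy⟩ := Part.mem_bind_iff.1 hy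
    exact .letAll (fun i => (hG i).yields s v _ hs (get_mem_of_mem_mOfFn hw i))
      (fun i => isValue_num _) fun t ht _ => hF.yields t w y ht hy

theorem prec {F G : Term} {f : List.Vector ℕ n → ℕ} {g : List.Vector ℕ (n + 2) → ℕ}
    (hF : Implements F fun v => Part.some (f v)) (hG : Implements G fun v => Part.some (g v)) :
    Implements
      (mlet (app (.var 0) unit) (app (app (fix (lam (precStep G))) (F.rename (· + 2))) (num 0)))
      fun v : List.Vector ℕ (n + 1) =>
        Part.some (v.head.rec (f v.tail) fun y IH => g (y ::ᵥ IH ::ᵥ v.tail)) where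
  hasType := by
    have hstep := hG.hasType.rename <|
      getElem?_upRen (getElem?_upRen (Γ := List.replicate n Num) (ρ := (· + 3))
        (Δ := .fn Num (.fn Num Num) :: .fn (.base .unit) (.base .bool) ::
          List.replicate (n + 1) Num) (fun _ _ h => h) Num) Num
    exact .mlet (.app (.var rfl) .unit) <| .app (.app (.fix (.lam (.ite (.app (.var rfl) .unit)
      (.app (.app (.var rfl) hstep) (hasType_succNum _)) (.var rfl))))
      (hF.hasType.rename fun _ _ h => h)) (hasType_num _ 0)
  yields s v y hs hy μ := by
    obtain ⟨k, v, rfl⟩ := v.exists_eq_cons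
    rw [List.Vector.head_cons, List.Vector.tail_cons, Part.mem_some_iff] at hy
    subst hy
    have hbase : Yields ((F.rename (· + 2)).subst (scons (iter μ.length k) s)) (num (f v)) := by
      rw [subst_rename]
      exact hF.yields _ v _ (fun i => hs i.succ) (Part.mem_some _)
    obtain ⟨ν, hbase⟩ := hbase (μ ++ List.replicate k true)
    obtain ⟨ν', hloop⟩ := evals_precStep hG (s := scons (iter μ.length k) s)
      (r := fun k => k.rec (f v) fun y IH => g (y ::ᵥ IH ::ᵥ v)) (fun _ => Part.mem_some _)
      k 0 ν rfl fun i => hs i.succ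
    refine ⟨ν', .mlet ?_ (isValue_iter _ _) <|
      .app (.app_fix hbase (isValue_num _) (.refl _ _)) (.refl _ _) (isValue_num 0) ?_⟩
    · have hiter := evals_app_num k μ
      rwa [← show s 0 = num k from hs 0] at hiter
    · rw [List.append_assoc]
      exact hloop

theorem rfind {T : Term} {f : List.Vector ℕ (n + 1) →. ℕ} (hT : Implements T f) :
    Implements (app (fix (searchStep T)) (num 0)) fun v =>
      Nat.rfind fun k => (f (k ::ᵥ v)).map fun m => decide (m = 0) where
  hasType :=
    .app (.fix (.ite (.isPos <| hT.hasType.rename <|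
        getElem?_upRen (Γ := List.replicate n Num) (ρ := (· + 1)) (fun _ _ h => h) _)
      (.app (.var rfl) (hasType_succNum _)) (.var rfl))) (hasType_num _ 0)
  yields s v y hs hy := by
    obtain ⟨hy, hlt⟩ := Nat.mem_rfind.1 hy
    simp only [Part.mem_map_iff, decide_eq_true_eq, decide_eq_false_iff_not] at hy hlt
    obtain ⟨_, hy, rfl⟩ := hy
    refine .app_fix (.refl _) (isValue_num 0) (yields_searchStep hT hs y.zero_le hy fun j hj => ?_)
    obtain ⟨m, hm, hm₀⟩ := hlt hj
    exact ⟨m - 1, by rwa [Nat.sub_add_cancel (Nat.pos_of_ne_zero hm₀)]⟩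

end Implements

theorem exists_implements_of_primrec' {n : ℕ} {f : List.Vector ℕ n → ℕ} (hf : Nat.Primrec' f) :
    ∃ M, Implements M fun v => Part.some (f v) := by
  induction hf with
  | zero => exact ⟨_, .zero⟩
  | succ => exact ⟨_, .succ⟩
  | get i => exact ⟨_, .var i⟩
  | comp g _ _ ihf ihg =>
    obtain ⟨F, hF⟩ := ihf
    choose G hG using ihg
    exact ⟨_, by
      simpa only [← Part.pure_eq_some, List.Vector.mOfFn_pure, pure_bind] using hF.comp hG⟩
  | prec _ _ ihf ihg =>
    obtain ⟨F, hF⟩ := ihf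
    obtain ⟨G, hG⟩ := ihg
    exact ⟨_, hF.prec hG⟩

theorem exists_implements_of_partrec' {n : ℕ} {f : List.Vector ℕ n →. ℕ} (hf : Nat.Partrec' f) :
    ∃ M, Implements M f := by
  induction hf with
  | prim hf => exact exists_implements_of_primrec' hf
  | comp g _ _ ihf ihg =>
    obtain ⟨F, hF⟩ := ihf
    choose G hG using ihg
    exact ⟨_, hF.comp hG⟩
  | rfind _ ih =>
    obtain ⟨T, hT⟩ := ih
    exact ⟨_, by simpa using hT.rfind⟩

/-! ### The reduction -/

/-- The expression that fails if `P` computes a positive number at the argument `n`, and returns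
`()` if it computes `0`. -/
def query (P : Term) (n : ℕ) : Term := mlet (num n) (ite (isPos P) fail unit)

theorem Term.primrec_lam : Primrec lam :=
  ((Primrec.ofNat Term).comp (Primrec.nat_add.comp (Primrec.nat_mul.comp (.const 9)
    Primrec.encode) (.const 6))).of_eq fun M => ofCode_code (.lam M)

theorem Term.primrec₂_app : Primrec₂ app :=
  ((Primrec.ofNat Term).comp (Primrec.nat_add.comp (Primrec.nat_mul.comp (.const 9)
    (Primrec₂.natPair.comp (Primrec.encode.comp Primrec.fst) (Primrec.encode.comp Primrec.snd)))
    (.const 7))).of_eq fun p => ofCode_code (.app p.1 p.2)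

theorem primrec_num : Primrec num := by
  have hstep : Primrec fun M : Term => lam (mlet (app M unit) succBody) :=
    primrec_lam.comp (primrec₂_app.comp (.const _) (primrec₂_app.comp .id (.const _)))
  refine (Primrec.nat_rec₁ (num 0) (hstep.comp Primrec.snd).to₂).of_eq fun n => ?_
  induction n with
  | zero => rfl
  | succ n ih => exact congrArg (fun M => lam (mlet (app M unit) succBody)) ih

theorem primrec_query (P : Term) : Primrec (query P) :=
  primrec₂_app.comp (.const _) primrec_num

section

variable {P : Term} {f : List.Vector ℕ 1 →. ℕ}

theorem isInstance_query (hP : Implements P f) (n : ℕ) : IsInstance (query P n) :=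
  ⟨.unit, .mlet (hasType_num _ n) (.ite (.isPos hP.hasType) .fail .unit)⟩

theorem reaches_query_iff (hP : Implements P f) {n y : ℕ} (hy : y ∈ f (n ::ᵥ .nil)) :
    Reaches (query P n) ↔ 0 < y := by
  have hrun : Yields (P.subst (scons (num n) Term.var)) (num y) :=
    hP.yields _ _ _ (fun i => by rw [Subsingleton.elim i 0]; rfl) hy
  have hquery {V : Term} (hV : Yields ((ite (isPos P) fail unit).subst (scons (num n) .var)) V) :
      Yields (query P n) V := by
    rw [← subst_var (query P n)]
    exact .mlet (by rw [subst_var]; exact .refl _) (isValue_num n) hV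
  cases y with
  | zero =>
    obtain ⟨μ, h⟩ := hquery (.ite_false (.isPos_zero hrun) (.refl _)) []
    exact iff_of_false (not_reaches_of_isValue .unit (h .hole)) (lt_irrefl 0)
  | succ y =>
    obtain ⟨μ, h⟩ := hquery (.ite_true (.isPos_succ hrun) (.refl _)) []
    exact iff_of_true ⟨_, h .hole⟩ y.succ_pos

end

theorem exists_query_of_partrec {u : ℕ →. Bool} (hu : Partrec u) :
    ∃ P, ∀ n, IsInstance (query P n) ∧ ∀ a ∈ u n, (Reaches (query P n) ↔ a = true) := by
  obtain ⟨P, hP⟩ := exists_implements_of_partrec' (Nat.Partrec'.part_iff₁.2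
    (hu.map (Computable.encode.comp Computable.snd).to₂))
  refine ⟨P, fun n => ⟨isInstance_query hP n, fun a ha => ?_⟩⟩
  rw [reaches_query_iff hP (Part.mem_map _ ha)]
  cases a <;> simp

theorem exists_partrec_forall_partrec_exists_eq (α : Type*) [Primcodable α] :
    ∃ u : ℕ →. α, Partrec u ∧ ∀ f : ℕ →. α, Partrec f → ∃ n, f n = u n := by
  refine ⟨fun n => ((Denumerable.ofNat Nat.Partrec.Code n).eval n).bind fun m =>
    (Encodable.decode m : Option α), ?_, fun f hf => ?_⟩
  · exact (Nat.Partrec.Code.eval_part.comp (Computable.ofNat _) Computable.id).bind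
      (Computable.decode.comp Computable.snd).ofOption.to₂
  · obtain ⟨c, hc⟩ := Nat.Partrec.Code.exists_code.1
      (Partrec.nat_iff.1 (hf.map (Computable.encode.comp Computable.snd).to₂))
    exact ⟨Encodable.encode c, by simp [hc, Part.bind_map]⟩

end BPCFR

theorem mainTheorem4 : ¬ BPCFR.ReachabilityDecidable := by
  rintro ⟨f, hf, hdecides⟩
  obtain ⟨u, hu, hmeets⟩ := BPCFR.exists_partrec_forall_partrec_exists_eq Bool
  obtain ⟨P, hP⟩ := BPCFR.exists_query_of_partrec hu
  have hnot : Partrec fun n => (f (BPCFR.query P n)).map not :=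
    (hf.comp (BPCFR.primrec_query P).to_comp).map (Primrec.not.to_comp.comp Computable.snd).to₂
  obtain ⟨n, hn⟩ := hmeets _ hnot
  obtain ⟨hinstance, hreaches⟩ := hP n
  obtain ⟨a, ha, hanswer⟩ := hdecides _ hinstance
  have hu_not : (!a) ∈ u n := hn ▸ Part.mem_map not ha
  have hcontra : a = true ↔ (!a) = true := hanswer.trans (hreaches _ hu_not)
  cases a <;> simp at hcontra
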